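/- Let $n\ge 4$ and let $|a\rangle,|a]\in\mathbb{C}^2$ ($a=1,\dots,n$) be spinors of $n$ massless four-dimensional momenta $k_a=|a\rangle|a]$ with $\sum_a k_a=0$. Write $\langle ab\rangle$, $[ab]$ for the antisymmetric spinor products, and $s_{ab}=2k_a\cdot k_b=-\langle ab\rangle[ab]$. A solution of the scattering equations is a tuple $\sigma=(\sigma_1,\dots,\sigma_n)$ of pairwise distinct complex numbers with $$\sum_{b\neq a}\frac{s_{ab}}{\sigma_{ab}}=0\quad(a=1,\dots,n),\qquad \sigma_{ab}=\sigma_a-\sigma_b ;$$ solutions are counted modulo Möbius transformations of the Riemann sphere. Assume the momenta are generic in the sense that every solution is nondegenerate, i.e. the Jacobian matrix $\Phi_{ab}=s_{ab}/\sigma_{ab}^2$ $(a\ne b)$, $\Phi_{aa}=-\sum_{c\neq a}s_{ac}/\sigma_{ac}^2$, has its maximal rank $n-3$ at every solution (equivalently $\det{}'\Phi(\sigma)\neq0$). Fix reference spinors $|p\rangle,|q]$ with $\langle ap\rangle\neq0$ and $[aq]\ne0$ for all $a$, and let $\mathfrak{C}_\pm(\sigma)$ be the $n\times n$ matrices $$(\mathfrak{C}_-)_{ab}=\frac{\langle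 ab\rangle}{\sigma_{ab}},\quad(\mathfrak{C}_+)_{ab}=\frac{[ab]}{\sigma_{ab}}\quad(a\neq b),\qquad(\mathfrak{C}_-)_{aa}=-\sum_{b\neq a}\frac{\langle ab\rangle[bq]}{\sigma_{ab}[aq]},\quad(\mathfrak{C}_+)_{aa}=-\sum_{b\neq a}\frac{[ab]\langle bp\rangle}{\sigma_{ab}\langle ap\rangle}.$$ Let $P_\pm(n-3,m)$ be the set of solutions $\sigma$ with $\operatorname{rank}\mathfrak{C}_\pm(\sigma)=m+1$. Then: 1. Every solution lies in $P_-(n-3,m)$ for some $0\le m\le n-4$, and for every $\sigma\in P_-(n-3,m)$ one has $m\le n-4$, $$\operatorname{rank}\mathfrak{C}_-(\sigma)=m+1,\qquad\operatorname{rank}\mathfrak{C}_+(\sigma)=n-m-3,$$ so the two ranks sum to $n-2$. 2. $P_+(n-3,n-k-4)=P_-(n-3,k)$ for all $0\le k\le n-4$. 3. If moreover all momenta $k_a$ are real (Minkowski signature), then for all $0\le k\le n-4$, with $P^*=\{\sigma^*:\sigma\in P\}$ the set of complex conjugates, $$P_+(n-3,n-k-4)=P_-^*(n-3,n-k-4)=P_-(n-3,k).$$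 Thus $P_-(n-3,k)$ and $P_-(n-3,n-k-4)$ are complex conjugates of each other, and they contain the same number of Möbius classes of solutions. -/

import Mathlib

noncomputable section

namespace CHY

/-- Angle bracket of two (undotted) spinors. -/
def angle (x y : Fin 2 → ℂ) : ℂ := x 0 * y 1 - x 1 * y 0

/-- Square bracket of two (dotted) spinors; the sign is such that `2 k_a · k_b = -⟨ab⟩[ab]`. -/
def square (x y : Fin 2 → ℂ) : ℂ := x 1 * y 0 - x 0 * y 1

/-- The four-vector `k` with `k⁰ + k³ = x₀ y₀`, `k¹ - i k² = x₀ y₁`, `k¹ + i k² = x₁ y₀`,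
`k⁰ - k³ = x₁ y₁`, i.e. the null momentum with spinors `x = |k⟩` and `y = |k]`. -/
def momentum (x y : Fin 2 → ℂ) : Fin 4 → ℂ :=
  ![(x 0 * y 0 + x 1 * y 1) / 2, (x 0 * y 1 + x 1 * y 0) / 2,
    Complex.I * (x 0 * y 1 - x 1 * y 0) / 2, (x 0 * y 0 - x 1 * y 1) / 2]

/-- The (complex bilinear) Minkowski product of signature `(+,-,-,-)`. -/
def minkowski (k l : Fin 4 → ℂ) : ℂ := k 0 * l 0 - k 1 * l 1 - k 2 * l 2 - k 3 * l 3

/-- Four-dimensional kinematics of `n` massless particles in spinor-helicity variables: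
`lam a = |a⟩`, `lamT a = |a]`, with conserved total momentum. -/
structure Kinematics (n : ℕ) where
  lam : Fin n → Fin 2 → ℂ
  lamT : Fin n → Fin 2 → ℂ
  conservation : ∑ a, momentum (lam a) (lamT a) = 0

variable {n : ℕ}

namespace Kinematics

/-- The momentum `k_a` of particle `a`. -/
def mom (K : Kinematics n) (a : Fin n) : Fin 4 → ℂ := momentum (K.lam a) (K.lamT a)

/-- The Mandelstam variables `s_ab = 2 k_a · k_b`. -/
def s (K : Kinematics n) (a b : Fin n) : ℂ := 2 * minkowski (K.mom a) (K.mom b)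

theorem s_eq (K : Kinematics n) (a b : Fin n) :
    K.s a b = -(angle (K.lam a) (K.lam b) * square (K.lamT a) (K.lamT b)) := by
  simp only [s, minkowski, mom, momentum, angle, square, Matrix.cons_val]
  linear_combination (-(1 / 2) * (K.lam a 0 * K.lamT a 1 - K.lam a 1 * K.lamT a 0) *
    (K.lam b 0 * K.lamT b 1 - K.lam b 1 * K.lamT b 0)) * Complex.I_mul_I

/-- All momenta are real vectors of Minkowski space. -/
def IsReal (K : Kinematics n) : Prop := ∀ a μ, (K.mom a μ).im = 0

/-- `σ` is a solution of the scattering equations: `n` pairwise distinct punctures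
with `∑_{b ≠ a} s_ab / (σ_a - σ_b) = 0` for every `a`. -/
def IsSolution (K : Kinematics n) (σ : Fin n → ℂ) : Prop :=
  Function.Injective σ ∧
    ∀ a, ∑ b ∈ Finset.univ.erase a, K.s a b / (σ a - σ b) = 0

/-- The Jacobian matrix `Φ_ab = ∂_{σ_b} ∑_{c ≠ a} s_ac / (σ_a - σ_c)` of the scattering
equations. -/
def Phi (K : Kinematics n) (σ : Fin n → ℂ) : Matrix (Fin n) (Fin n) ℂ :=
  Matrix.of fun a b =>
    if a = b then -∑ c ∈ Finset.univ.erase a, K.s a c / (σ a - σ c) ^ 2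
    else K.s a b / (σ a - σ b) ^ 2

/-- The solution `σ` is nondegenerate (`det' Φ(σ) ≠ 0`): the Jacobian matrix, which always
annihilates the three infinitesimal Möbius directions, has the maximal possible rank `n - 3`. -/
def IsNondegenerate (K : Kinematics n) (σ : Fin n → ℂ) : Prop := (K.Phi σ).rank + 3 = n

/-- The discriminant matrix `ℭ₋(σ)`, with reference spinor `|q]`. -/
def discMinus (K : Kinematics n) (q : Fin 2 → ℂ) (σ : Fin n → ℂ) : Matrix (Fin n) (Fin n) ℂ :=
  Matrix.of fun a b =>
    if a = b then
      -∑ c ∈ Finset.univ.erase a,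
        angle (K.lam a) (K.lam c) * square (K.lamT c) q /
          ((σ a - σ c) * square (K.lamT a) q)
    else angle (K.lam a) (K.lam b) / (σ a - σ b)

/-- The discriminant matrix `ℭ₊(σ)`, with reference spinor `|p⟩`. -/
def discPlus (K : Kinematics n) (p : Fin 2 → ℂ) (σ : Fin n → ℂ) : Matrix (Fin n) (Fin n) ℂ :=
  Matrix.of fun a b =>
    if a = b then
      -∑ c ∈ Finset.univ.erase a,
        square (K.lamT a) (K.lamT c) * angle (K.lam c) p /
          ((σ a - σ c) * angle (K.lam a) p)
    else square (K.lamT a) (K.lamT b) / (σ a - σ b)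

/-- The class `P₋(n-3, m)`: solutions with `rank ℭ₋ = m + 1`. -/
def PMinus (K : Kinematics n) (q : Fin 2 → ℂ) (m : ℕ) : Set (Fin n → ℂ) :=
  {σ | K.IsSolution σ ∧ (K.discMinus q σ).rank = m + 1}

/-- The class `P₊(n-3, m)`: solutions with `rank ℭ₊ = m + 1`. -/
def PPlus (K : Kinematics n) (p : Fin 2 → ℂ) (m : ℕ) : Set (Fin n → ℂ) :=
  {σ | K.IsSolution σ ∧ (K.discPlus p σ).rank = m + 1}

end Kinematics

/-- The set `P*` of complex conjugates `σ* = (σ̄_1, …, σ̄_n)` of the members of `P`. -/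
def conjSet (P : Set (Fin n → ℂ)) : Set (Fin n → ℂ) :=
  (fun σ a => (starRingEnd ℂ) (σ a)) '' P

/-- Two puncture configurations are equivalent if a Möbius transformation of the Riemann sphere
`OnePoint ℂ` carries one to the other. -/
def mobiusSetoid (n : ℕ) : Setoid (Fin n → ℂ) where
  r σ τ := ∃ g : GL (Fin 2) ℂ, ∀ a, g • (σ a : OnePoint ℂ) = (τ a : OnePoint ℂ)
  iseqv :=
    { refl := fun _ => ⟨1, fun _ => one_smul _ _⟩
      symm := fun ⟨g, hg⟩ => ⟨g⁻¹, fun a => by rw [← hg a, inv_smul_smul]⟩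
      trans := fun ⟨g, hg⟩ ⟨h, hh⟩ => ⟨h * g, fun a => by rw [mul_smul, hg a, hh a]⟩ }

/-- The set of Möbius classes of a set of puncture configurations. -/
def mobiusClasses (P : Set (Fin n → ℂ)) : Set (Quotient (mobiusSetoid n)) :=
  Quotient.mk (mobiusSetoid n) '' P

end CHY

end

/-!
The scattering equations say that `∑ k_a / (z - σ_a)`, as a `2 × 2` matrix of rational functions,
has determinant zero. Cleared of denominators it is therefore a product `L(z) N(z)` of a column and
a row of polynomials, with `L` primitive. Nondegeneracy says that the kernel of `Φ` consists of the
quadratic polynomials in `σ`; this forces `N` to be primitive as well and `deg L + deg N = n - 2`.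
Up to a diagonal congruence and a sign, `ℭ₋` is the Bezout matrix of `L` at the nodes `σ_a`, with
rank `deg L`, and `ℭ₊` is that of `N`, with rank `deg N`. For real momenta the matrices `k_a` are
Hermitian, so complex conjugation of `σ` exchanges the roles of `L` and `N`.
-/

namespace CHY

open ComplexConjugate Lagrange Matrix Polynomial

section Nodes

theorem X_mul_mem_degreeLT {R : Type*} [Semiring R] {f : R[X]} {k : ℕ} (hf : f ∈ degreeLT R k) :
    X * f ∈ degreeLT R (k + 1) := by
  rw [mem_degreeLT, degree_lt_iff_coeff_zero] at hf ⊢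
  intro m hm
  obtain ⟨j, rfl⟩ := Nat.exists_eq_add_of_le' (Nat.one_le_of_lt hm)
  rw [coeff_X_mul]
  exact hf j (by omega)

variable {F ι : Type*} [Field F]

/-- Evaluation of polynomials at the nodes `σ`, as a linear map. -/
noncomputable def evalNodes (σ : ι → F) : F[X] →ₗ[F] (ι → F) :=
  LinearMap.pi fun a => leval (σ a)

@[simp]
theorem evalNodes_apply (σ : ι → F) (f : F[X]) (a : ι) : evalNodes σ f a = f.eval (σ a) := rfl

variable [Fintype ι] {σ : ι → F}

theorem eq_of_evalNodes_eq (hσ : Function.Injective σ) {f g : F[X]}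
    (hf : f.degree < Fintype.card ι) (hg : g.degree < Fintype.card ι)
    (h : evalNodes σ f = evalNodes σ g) : f = g :=
  eq_of_degrees_lt_of_eval_index_eq Finset.univ hσ.injOn hf hg fun a _ => congrFun h a

theorem finrank_map_evalNodes_degreeLT (hσ : Function.Injective σ) {k : ℕ}
    (hk : k ≤ Fintype.card ι) :
    Module.finrank F ((degreeLT F k).map (evalNodes σ)) = k := by
  have degree_lt : ∀ f ∈ degreeLT F k, f.degree < Fintype.card ι := fun f hf =>
    (mem_degreeLT.mp hf).trans_le (by exact_mod_cast hk)
  have hinj : Function.Injective ((evalNodes σ).domRestrict (degreeLT F k)) := fun f g h =>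
    Subtype.ext (eq_of_evalNodes_eq hσ (degree_lt f f.2) (degree_lt g g.2) h)
  rw [← LinearMap.range_domRestrict, LinearMap.finrank_range_of_inj hinj,
    (degreeLTEquiv F k).finrank_eq, Module.finrank_fin_fun]

variable [DecidableEq ι]

theorem coeff_card_sub_one_eq_sum (hσ : Function.Injective σ) {f : F[X]}
    (hf : f.degree < Fintype.card ι) :
    f.coeff (Fintype.card ι - 1) = ∑ a, nodalWeight Finset.univ σ a * f.eval (σ a) := by
  rw [← Finset.card_univ, coeff_eq_sum hσ.injOn hf]
  exact Finset.sum_congr rfl fun a _ => by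
    rw [nodalWeight, Finset.prod_inv_distrib, div_eq_inv_mul]

theorem degree_lt_card_sub_one (hσ : Function.Injective σ) {f : F[X]}
    (hf : f.degree < Fintype.card ι)
    (hsum : ∑ a, nodalWeight Finset.univ σ a * f.eval (σ a) = 0) :
    f.degree < (Fintype.card ι - 1 : ℕ) := by
  refine degree_lt_iff_coeff_zero _ _ |>.mpr fun m hm => ?_
  rcases hm.eq_or_lt with rfl | hlt
  · rw [coeff_card_sub_one_eq_sum hσ hf, hsum]
  · exact coeff_eq_zero_of_degree_lt (hf.trans_le (by exact_mod_cast (by omega)))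

theorem coeff_card_sub_two_eq_sum (hσ : Function.Injective σ) (hcard : 2 ≤ Fintype.card ι)
    {f : F[X]} (hf : f.degree < (Fintype.card ι - 1 : ℕ)) :
    f.coeff (Fintype.card ι - 2) =
      ∑ a, nodalWeight Finset.univ σ a * (σ a * f.eval (σ a)) := by
  have hXf : (X * f : F[X]).degree < Fintype.card ι := by
    have hmem := X_mul_mem_degreeLT (mem_degreeLT.mpr hf)
    rwa [Nat.sub_add_cancel (by omega), mem_degreeLT] at hmem
  rw [← coeff_X_mul, show Fintype.card ι - 2 + 1 = Fintype.card ι - 1 by omega,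
    coeff_card_sub_one_eq_sum hσ hXf]
  simp only [eval_mul, eval_X]

theorem nodalWeight_map {F' : Type*} [Field F'] (φ : F →+* F') (σ : ι → F) (a : ι) :
    nodalWeight Finset.univ (φ ∘ σ) a = φ (nodalWeight Finset.univ σ a) := by
  simp only [nodalWeight, map_prod, map_inv₀, map_sub, Function.comp_apply]

theorem X_sub_C_mul_basis (σ : ι → F) (a : ι) :
    (X - C (σ a)) * Lagrange.basis Finset.univ σ a =
      C (nodalWeight Finset.univ σ a) * nodal Finset.univ σ := by
  rw [basis_eq_prod_sub_inv_mul_nodal_div (Finset.mem_univ a),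
    ← nodal_erase_eq_nodal_div (Finset.mem_univ a), nodal_eq_mul_nodal_erase (Finset.mem_univ a)]
  ring

end Nodes

section PolynomialPairs

theorem exists_eq_mul_of_isCoprime {R : Type*} [CommRing R] {x y u v : R} (hxy : IsCoprime x y)
    (h : x * v = y * u) : ∃ f, u = x * f ∧ v = y * f := by
  obtain ⟨a, b, hab⟩ := hxy
  refine ⟨a * u + b * v, ?_, ?_⟩
  · linear_combination -u * hab - b * h
  · linear_combination -v * hab + a * h

/-- The degree of the map to the projective line with homogeneous coordinates `L 0`, `L 1`,
when these are coprime. -/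
def pairDegree {R : Type*} [Semiring R] (L : Fin 2 → R[X]) : ℕ :=
  max (L 0).natDegree (L 1).natDegree

/-- The value at `z` of a pair of polynomials: the spinor `L(z)`. -/
def evalPair {R : Type*} [Semiring R] (L : Fin 2 → R[X]) (z : R) : Fin 2 → R :=
  fun i => (L i).eval z

section Semiring

variable {R : Type*} [Semiring R] (L : Fin 2 → R[X])

theorem natDegree_le_pairDegree (i : Fin 2) : (L i).natDegree ≤ pairDegree L := by
  fin_cases i
  exacts [le_max_left _ _, le_max_right _ _]

variable {L}

theorem exists_natDegree_eq_pairDegree (hL : L ≠ 0) :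
    ∃ i, L i ≠ 0 ∧ (L i).natDegree = pairDegree L := by
  obtain ⟨j, hj⟩ := Function.ne_iff.mp hL
  obtain ⟨i, hi⟩ : ∃ i, (L i).natDegree = pairDegree L :=
    (max_choice (L 0).natDegree (L 1).natDegree).elim (fun h => ⟨0, h.symm⟩) fun h => ⟨1, h.symm⟩
  by_cases hi0 : L i = 0
  · have h0 : pairDegree L = 0 := by rw [← hi, hi0, natDegree_zero]
    exact ⟨j, hj, le_antisymm (natDegree_le_pairDegree L j) (by omega)⟩
  · exact ⟨i, hi0, hi⟩

theorem evalPair_eq_of_pairDegree_eq_zero (h : pairDegree L = 0) (z w : R) :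
    evalPair L z = evalPair L w := by
  funext i
  have hi : (L i).natDegree = 0 := Nat.le_zero.mp (h ▸ natDegree_le_pairDegree L i)
  rw [evalPair, evalPair, eq_C_of_natDegree_eq_zero hi, eval_C, eval_C]

end Semiring

theorem forall_degree_mul_lt_iff {R : Type*} [Semiring R] [NoZeroDivisors R] {L : Fin 2 → R[X]}
    (hL : L ≠ 0) {k : ℕ} {f : R[X]} :
    (∀ i, (L i * f).degree < k) ↔ f ∈ degreeLT R (k - pairDegree L) := by
  rcases eq_or_ne f 0 with rfl | hf
  · simp
  rw [mem_degreeLT, ← natDegree_lt_iff_degree_lt hf, lt_tsub_iff_left]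
  constructor
  · intro h
    obtain ⟨i, hi, hdeg⟩ := exists_natDegree_eq_pairDegree hL
    rw [← hdeg, ← natDegree_mul hi hf, natDegree_lt_iff_degree_lt (mul_ne_zero hi hf)]
    exact h i
  · intro h i
    by_cases hi : L i = 0
    · simp [hi]
    rw [← natDegree_lt_iff_degree_lt (mul_ne_zero hi hf), natDegree_mul hi hf]
    exact (Nat.add_le_add_right (natDegree_le_pairDegree L i) _).trans_lt h

theorem evalPair_ne_zero {R : Type*} [CommRing R] [Nontrivial R] {L : Fin 2 → R[X]}
    (hL : IsCoprime (L 0) (L 1)) (z : R) : evalPair L z ≠ 0 :=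
  IsCoprime.ne_zero (hL.map (evalRingHom z))

theorem isCoprime_of_evalPair_ne_zero {F : Type*} [Field F] [IsAlgClosed F] {L : Fin 2 → F[X]}
    (hL : ∀ z, evalPair L z ≠ 0) : IsCoprime (L 0) (L 1) := by
  refine (isCoprime_iff_aeval_ne_zero_of_isAlgClosed F F _ _).mpr fun z => ?_
  by_contra! hz
  refine hL z (funext fun i => ?_)
  fin_cases i
  exacts [hz.1, hz.2]

theorem pairDegree_add_pairDegree {R : Type*} [Semiring R] [NoZeroDivisors R]
    {L N : Fin 2 → R[X]} {d : ℕ} (hlt : ∀ i j, (L i * N j).degree < (d + 1 : ℕ))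
    (hcoeff : ∃ i j, (L i * N j).coeff d ≠ 0) : pairDegree L + pairDegree N = d := by
  obtain ⟨i, j, hij⟩ := hcoeff
  obtain ⟨hi, hj⟩ := mul_ne_zero_iff.mp fun h0 => hij (by rw [h0, coeff_zero])
  obtain ⟨k, hk, hkdeg⟩ := exists_natDegree_eq_pairDegree (Function.ne_iff.mpr ⟨i, hi⟩)
  obtain ⟨l, hl, hldeg⟩ := exists_natDegree_eq_pairDegree (Function.ne_iff.mpr ⟨j, hj⟩)
  have hle : (L k * N l).natDegree < d + 1 :=
    (natDegree_lt_iff_degree_lt (mul_ne_zero hk hl)).mpr (hlt k l)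
  have hge := le_natDegree_of_ne_zero hij
  rw [natDegree_mul hk hl] at hle
  rw [natDegree_mul hi hj] at hge
  have := natDegree_le_pairDegree L i
  have := natDegree_le_pairDegree N j
  omega

theorem pairDegree_map {F S : Type*} [DivisionRing F] [Semiring S] [Nontrivial S] (φ : F →+* S)
    (L : Fin 2 → F[X]) : pairDegree (fun i => (L i).map φ) = pairDegree L := by
  simp only [pairDegree, natDegree_map]

theorem evalPair_map {R S : Type*} [Semiring R] [Semiring S] (φ : R →+* S) (L : Fin 2 → R[X])
    (z : R) : evalPair (fun i => (L i).map φ) (φ z) = φ ∘ evalPair L z :=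
  funext fun _ => eval_map_apply φ z

theorem exists_eq_vecMulVec_of_det_eq_zero {R : Type*} [CommRing R] [IsDomain R] [IsBezout R]
    {A : Matrix (Fin 2) (Fin 2) R} (hA : A.det = 0) :
    ∃ L N : Fin 2 → R, IsCoprime (L 0) (L 1) ∧ A = vecMulVec L N := by
  by_cases hA0 : A = 0
  · exact ⟨![1, 0], 0, isCoprime_one_left, by rw [hA0, vecMulVec_zero]⟩
  obtain ⟨j, hj⟩ : ∃ j, ¬(A 0 j = 0 ∧ A 1 j = 0) := by
    by_contra! h
    exact hA0 (by ext i k; fin_cases i; exacts [(h k).1, (h k).2])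
  obtain ⟨x, hx⟩ := IsBezout.gcd_dvd_left (A 0 j) (A 1 j)
  obtain ⟨y, hy⟩ := IsBezout.gcd_dvd_right (A 0 j) (A 1 j)
  obtain ⟨u, v, huv⟩ := IsBezout.gcd_eq_sum (A 0 j) (A 1 j)
  set g := IsBezout.gcd (A 0 j) (A 1 j)
  have hg : g ≠ 0 := fun h0 => hj ⟨by rw [hx, h0, zero_mul], by rw [hy, h0, zero_mul]⟩
  have hxy : IsCoprime x y :=
    ⟨u, v, mul_left_cancel₀ hg (by linear_combination huv - u * hx - v * hy)⟩
  have hminor : ∀ j k, A 0 j * A 1 k = A 1 j * A 0 k := by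
    rw [det_fin_two] at hA
    simp only [Fin.forall_fin_two]
    exact ⟨⟨by ring, by linear_combination hA⟩, ⟨by linear_combination -hA, by ring⟩⟩
  have hcol : ∀ k, x * A 1 k = y * A 0 k := fun k =>
    mul_left_cancel₀ hg (by linear_combination hminor j k - A 1 k * hx + A 0 k * hy)
  choose N hN using fun k => exists_eq_mul_of_isCoprime hxy (hcol k)
  refine ⟨![x, y], N, hxy, ?_⟩
  ext i k
  fin_cases i
  exacts [(hN k).1, (hN k).2]

end PolynomialPairs

section Bezoutian

variable {F ι : Type*} [Field F]

/-- The Bezoutian `(L₀(z) L₁(x) - L₁(z) L₀(x)) / (z - x)` of a pair, as a polynomial in `z`. -/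
noncomputable def bezoutian (L : Fin 2 → F[X]) (x : F) : F[X] :=
  (L 0 * C ((L 1).eval x) - L 1 * C ((L 0).eval x)) /ₘ (X - C x)

theorem X_sub_C_mul_bezoutian (L : Fin 2 → F[X]) (x : F) :
    (X - C x) * bezoutian L x = L 0 * C ((L 1).eval x) - L 1 * C ((L 0).eval x) :=
  mul_divByMonic_eq_iff_isRoot.mpr (by simp [IsRoot.def, mul_comm])

theorem eval_bezoutian_of_ne (L : Fin 2 → F[X]) {x z : F} (h : z ≠ x) :
    (bezoutian L x).eval z =
      ((L 0).eval z * (L 1).eval x - (L 1).eval z * (L 0).eval x) / (z - x) := by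
  rw [eq_div_iff (sub_ne_zero.mpr h), mul_comm]
  simpa using congrArg (eval z) (X_sub_C_mul_bezoutian L x)

theorem bezoutian_mem_degreeLT {L : Fin 2 → F[X]} {k : ℕ} (hL : pairDegree L < k) (x : F) :
    bezoutian L x ∈ degreeLT F k := by
  have hLk : ∀ i y, L i * C y ∈ degreeLT F k := fun i y => by
    rw [mul_comm, ← smul_eq_C_mul]
    exact Submodule.smul_mem _ _ (mem_degreeLT.mpr (degree_le_natDegree.trans_lt
      (by exact_mod_cast (natDegree_le_pairDegree L i).trans_lt hL)))
  exact mem_degreeLT.mpr ((degree_divByMonic_le _ _).trans_lt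
    (mem_degreeLT.mp (Submodule.sub_mem _ (hLk 0 _) (hLk 1 _))))

/-- The matrix of values of the Bezoutian at all pairs of nodes. -/
noncomputable def bezoutMatrix (L : Fin 2 → F[X]) (σ : ι → F) : Matrix ι ι F :=
  of fun a b => (bezoutian L (σ b)).eval (σ a)

variable [Fintype ι] {σ : ι → F} {L : Fin 2 → F[X]}

section

variable [DecidableEq ι]

theorem nodal_mul_sum_bezoutian (L : Fin 2 → F[X]) (σ u : ι → F) :
    nodal Finset.univ σ * ∑ b, C (nodalWeight Finset.univ σ b * u b) * bezoutian L (σ b) =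
      L 0 * interpolate Finset.univ σ (u * evalNodes σ (L 1)) -
        L 1 * interpolate Finset.univ σ (u * evalNodes σ (L 0)) := by
  simp only [interpolate_apply, Finset.mul_sum, ← Finset.sum_sub_distrib, Pi.mul_apply,
    evalNodes_apply, C_mul]
  refine Finset.sum_congr rfl fun b _ => ?_
  linear_combination (-C (u b) * bezoutian L (σ b)) * X_sub_C_mul_basis σ b +
    (C (u b) * Lagrange.basis Finset.univ σ b) * X_sub_C_mul_bezoutian L (σ b)

theorem bezoutMatrix_mulVec_eq_zero_iff (hσ : Function.Injective σ)
    (hL : pairDegree L < Fintype.card ι) (u : ι → F) :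
    bezoutMatrix L σ *ᵥ (nodalWeight Finset.univ σ * u) = 0 ↔
      L 0 * interpolate Finset.univ σ (u * evalNodes σ (L 1)) =
        L 1 * interpolate Finset.univ σ (u * evalNodes σ (L 0)) := by
  set f := ∑ b, C (nodalWeight Finset.univ σ b * u b) * bezoutian L (σ b) with hf
  have hvalues : bezoutMatrix L σ *ᵥ (nodalWeight Finset.univ σ * u) = evalNodes σ f := by
    funext a
    simp [hf, bezoutMatrix, mulVec, dotProduct, eval_finsetSum, mul_comm]
  have hdegree : f.degree < Fintype.card ι := mem_degreeLT.mp <|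
    Submodule.sum_mem _ fun b _ => smul_eq_C_mul (R := F) _ ▸
      Submodule.smul_mem _ _ (bezoutian_mem_degreeLT hL _)
  rw [← sub_eq_zero (a := L 0 * _), ← nodal_mul_sum_bezoutian, mul_eq_zero,
    or_iff_right nodal_ne_zero, hvalues, ← hf]
  exact ⟨fun h => eq_of_evalNodes_eq hσ hdegree (by simp) (by rw [h, map_zero]),
    fun h => by rw [h, map_zero]⟩

theorem interpolate_evalNodes_mul (hσ : Function.Injective σ) {f g : F[X]}
    (hfg : (f * g).degree < Fintype.card ι) :
    interpolate Finset.univ σ (evalNodes σ f * evalNodes σ g) = f * g :=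
  (eq_interpolate_of_eval_eq _ hσ.injOn hfg fun a _ => by simp).symm

theorem mem_map_evalNodes_iff (hσ : Function.Injective σ) (hcop : IsCoprime (L 0) (L 1))
    (hL : pairDegree L < Fintype.card ι) (u : ι → F) :
    u ∈ (degreeLT F (Fintype.card ι - pairDegree L)).map (evalNodes σ) ↔
      bezoutMatrix L σ *ᵥ (nodalWeight Finset.univ σ * u) = 0 := by
  have hL0 : L ≠ 0 := hcop.ne_zero
  rw [bezoutMatrix_mulVec_eq_zero_iff hσ hL]
  constructor
  · rintro ⟨f, hf, rfl⟩
    have hdegree : ∀ i, (f * L i).degree < Fintype.card ι := fun i =>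
      mul_comm (L i) f ▸ (forall_degree_mul_lt_iff hL0).mpr hf i
    rw [interpolate_evalNodes_mul hσ (hdegree 0), interpolate_evalNodes_mul hσ (hdegree 1)]
    ring
  · intro h
    obtain ⟨f, hf₀, hf₁⟩ := exists_eq_mul_of_isCoprime hcop h
    have hf : ∀ i, interpolate Finset.univ σ (u * evalNodes σ (L i)) = L i * f :=
      Fin.forall_fin_two.mpr ⟨hf₀, hf₁⟩
    refine ⟨f, (forall_degree_mul_lt_iff hL0).mp fun i => ?_, funext fun a => ?_⟩
    · rw [← hf i]
      exact degree_interpolate_lt _ hσ.injOn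
    · obtain ⟨i, hi⟩ := Function.ne_iff.mp (evalPair_ne_zero hcop (σ a))
      have hfa := congrArg (eval (σ a)) (hf i)
      rw [eval_interpolate_at_node _ hσ.injOn (Finset.mem_univ a), eval_mul, Pi.mul_apply,
        evalNodes_apply, mul_comm] at hfa
      exact (mul_left_cancel₀ hi hfa).symm

end

theorem rank_bezoutMatrix (hσ : Function.Injective σ) (hcop : IsCoprime (L 0) (L 1))
    (hL : pairDegree L < Fintype.card ι) : (bezoutMatrix L σ).rank = pairDegree L := by
  classical
  have hweights : (diagonal (nodalWeight Finset.univ σ)).det ≠ 0 := by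
    rw [det_diagonal]
    exact Finset.prod_ne_zero_iff.mpr fun a ha => nodalWeight_ne_zero hσ.injOn ha
  have hker : (bezoutMatrix L σ * diagonal (nodalWeight Finset.univ σ)).mulVecLin.ker =
      (degreeLT F (Fintype.card ι - pairDegree L)).map (evalNodes σ) := by
    ext u
    have hdiag : diagonal (nodalWeight Finset.univ σ) *ᵥ u = nodalWeight Finset.univ σ * u :=
      funext fun a => mulVec_diagonal _ _ a
    rw [mem_map_evalNodes_iff hσ hcop hL, LinearMap.mem_ker, mulVecLin_apply, ← mulVec_mulVec,
      hdiag]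
  have hnullity := LinearMap.finrank_range_add_finrank_ker
    (bezoutMatrix L σ * diagonal (nodalWeight Finset.univ σ)).mulVecLin
  rw [hker, finrank_map_evalNodes_degreeLT hσ (Nat.sub_le _ _), Module.finrank_fintype_fun_eq_card]
    at hnullity
  rw [← rank_mul_eq_left_of_det_ne_zero _ _ hweights, Matrix.rank]
  omega

end Bezoutian

section Matrices

theorem rank_neg {m ι R : Type*} [Fintype ι] [CommRing R] (A : Matrix m ι R) :
    (-A).rank = A.rank := by
  have hneg : (-A).mulVecLin = -A.mulVecLin := LinearMap.ext fun v => neg_mulVec v A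
  rw [Matrix.rank, hneg, LinearMap.range_neg, Matrix.rank]

theorem eq_of_off_diagonal_eq_of_mulVec_eq {ι R : Type*} [Fintype ι] [Ring R] [NoZeroDivisors R]
    {A B : Matrix ι ι R} {v : ι → R} (hv : ∀ a, v a ≠ 0) (hoff : ∀ a b, a ≠ b → A a b = B a b)
    (hmul : A *ᵥ v = B *ᵥ v) : A = B := by
  classical
  have hdiag : ∀ a, A a a = B a a := fun a => by
    have hrow := congrFun hmul a
    rw [mulVec, mulVec, dotProduct, dotProduct, ← Finset.add_sum_erase _ _ (Finset.mem_univ a),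
      ← Finset.add_sum_erase _ _ (Finset.mem_univ a),
      Finset.sum_congr rfl fun b hb => by rw [hoff a b (Finset.ne_of_mem_erase hb).symm]] at hrow
    exact mul_right_cancel₀ (hv a) (add_right_cancel hrow)
  ext a b
  rcases eq_or_ne a b with rfl | hab
  exacts [hdiag a, hoff a b hab]

theorem trace_adjugate_mul_comm {R : Type*} [CommRing R] (A B : Matrix (Fin 2) (Fin 2) R) :
    trace (adjugate A * B) = trace (adjugate B * A) := by
  simp only [adjugate_fin_two, trace_fin_two, mul_apply, Fin.sum_univ_two, of_apply, cons_val]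
  ring

theorem trace_adjugate_vecMulVec_mul (x y u v : Fin 2 → ℂ) :
    trace (adjugate (vecMulVec x y) * vecMulVec u v) = -(angle x u * square y v) := by
  simp only [adjugate_fin_two, trace_fin_two, mul_apply, Fin.sum_univ_two, of_apply, cons_val,
    vecMulVec_apply, angle, square]
  ring

end Matrices

namespace Kinematics

variable {n : ℕ} {K : Kinematics n} {σ : Fin n → ℂ}

/-- The momentum of particle `a` as the `2 × 2` matrix `|a⟩|a]`. -/
def bispinor (K : Kinematics n) (a : Fin n) : Matrix (Fin 2) (Fin 2) ℂ :=
  vecMulVec (K.lam a) (K.lamT a)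

theorem sum_bispinor (K : Kinematics n) : ∑ a, K.bispinor a = 0 := by
  have h : ∀ μ, ∑ a, momentum (K.lam a) (K.lamT a) μ = 0 := fun μ => by
    rw [← Finset.sum_apply, K.conservation, Pi.zero_apply]
  have h0 := h 0
  have h1 := h 1
  have h2 := h 2
  have h3 := h 3
  simp only [momentum, cons_val, ← Finset.sum_div, Finset.sum_add_distrib,
    Finset.sum_sub_distrib, ← Finset.mul_sum] at h0 h1 h2 h3
  set d := ∑ a, K.lam a 0 * K.lamT a 1 - ∑ a, K.lam a 1 * K.lamT a 0 with hd
  ext i j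
  simp only [Matrix.sum_apply, bispinor, vecMulVec_apply, Matrix.zero_apply]
  fin_cases i <;> fin_cases j <;> simp only [Fin.zero_eta, Fin.mk_one, Fin.isValue]
  · linear_combination h0 + h3
  · linear_combination h1 - Complex.I * h2 + (1 / 2) * d * Complex.I_sq - (1 / 2) * hd
  · linear_combination h1 + Complex.I * h2 - (1 / 2) * d * Complex.I_sq + (1 / 2) * hd
  · linear_combination h0 - h3

theorem s_eq_trace (K : Kinematics n) (a b : Fin n) :
    K.s a b = trace (adjugate (K.bispinor a) * K.bispinor b) := by
  rw [s_eq, bispinor, bispinor, trace_adjugate_vecMulVec_mul]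

theorem s_comm (K : Kinematics n) (a b : Fin n) : K.s a b = K.s b a := by
  rw [s_eq_trace, s_eq_trace, trace_adjugate_mul_comm]

theorem s_self (K : Kinematics n) (a : Fin n) : K.s a a = 0 := by
  rw [s_eq, angle, mul_comm (K.lam a 0), sub_self, zero_mul, neg_zero]

theorem trace_mul_sum_smul_bispinor (K : Kinematics n) (M : Matrix (Fin 2) (Fin 2) ℂ)
    (c : Fin n → ℂ) :
    trace (M * ∑ b, c b • K.bispinor b) = ∑ b, c b * trace (M * K.bispinor b) := by
  simp only [Matrix.mul_sum, Matrix.mul_smul, trace_sum, trace_smul, smul_eq_mul]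

theorem sum_mul_s_eq_zero {c : Fin n → ℂ} (hc : ∑ b, c b • K.bispinor b = 0) (a : Fin n) :
    ∑ b, c b * K.s a b = 0 := by
  simp only [s_eq_trace, ← trace_mul_sum_smul_bispinor, hc, mul_zero, trace_zero]

theorem sum_s_eq_zero (K : Kinematics n) (a : Fin n) : ∑ b, K.s a b = 0 := by
  simpa only [one_mul] using
    K.sum_mul_s_eq_zero (c := fun _ => 1) (by simpa only [one_smul] using K.sum_bispinor) a

theorem two_mul_det_sum_smul_bispinor (K : Kinematics n) (c : Fin n → ℂ) :
    2 * (∑ a, c a • K.bispinor a).det = ∑ a, c a * ∑ b, c b * K.s a b := by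
  set A := ∑ a, c a • K.bispinor a with hA
  calc 2 * A.det = trace (adjugate A * A) := by
        rw [adjugate_mul, trace_smul, trace_one, smul_eq_mul, mul_comm, Fintype.card_fin,
          Nat.cast_ofNat]
    _ = ∑ a, c a * trace (adjugate A * K.bispinor a) :=
        K.trace_mul_sum_smul_bispinor (adjugate A) c
    _ = ∑ a, c a * ∑ b, c b * K.s a b := by
        simp only [s_eq_trace, ← trace_mul_sum_smul_bispinor, ← hA, trace_adjugate_mul_comm _ A]

theorem IsSolution.sum_eq_zero (h : K.IsSolution σ) (a : Fin n) :
    ∑ b, K.s a b / (σ a - σ b) = 0 := by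
  rw [← Finset.add_sum_erase _ _ (Finset.mem_univ a), h.2 a, sub_self, div_zero, add_zero]

theorem IsSolution.det_sum_inv_smul_bispinor (h : K.IsSolution σ) {z : ℂ} (hz : ∀ a, z ≠ σ a) :
    (∑ a, (z - σ a)⁻¹ • K.bispinor a).det = 0 := by
  have hne : ∀ a, z - σ a ≠ 0 := fun a => sub_ne_zero.mpr (hz a)
  have partial_fractions : ∀ a b, (z - σ a)⁻¹ * ((z - σ b)⁻¹ * K.s a b) =
      (z - σ a)⁻¹ * (K.s a b / (σ a - σ b)) + (z - σ b)⁻¹ * (K.s b a / (σ b - σ a)) := by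
    intro a b
    rcases eq_or_ne a b with rfl | hab
    · simp only [s_self, zero_div, mul_zero, add_zero]
    have hab' := sub_ne_zero.mpr (h.1.ne hab)
    rw [K.s_comm b a, ← neg_sub (σ a) (σ b)]
    have := hne a
    have := hne b
    field_simp
    ring
  refine (mul_eq_zero_iff_left two_ne_zero).mp ((two_mul_det_sum_smul_bispinor K _).trans ?_)
  simp only [Finset.mul_sum, partial_fractions, Finset.sum_add_distrib]
  rw [Finset.sum_comm (f := fun a b => (z - σ b)⁻¹ * _)]
  simp only [← Finset.mul_sum, h.sum_eq_zero, mul_zero, Finset.sum_const_zero, add_zero]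

/-- The polynomial matrix `∏ (z - σ_a) · ∑ k_a / (z - σ_a)`, given by its values at the nodes. -/
noncomputable def momentumPoly (K : Kinematics n) (σ : Fin n → ℂ) :
    Matrix (Fin 2) (Fin 2) ℂ[X] :=
  of fun i j =>
    interpolate Finset.univ σ fun a => (nodalWeight Finset.univ σ a)⁻¹ * K.bispinor a i j

theorem momentumPoly_map_eval_node (K : Kinematics n) (hσ : Function.Injective σ) (a : Fin n) :
    (K.momentumPoly σ).map (eval (σ a)) = (nodalWeight Finset.univ σ a)⁻¹ • K.bispinor a := by
  ext i j
  exact eval_interpolate_at_node _ hσ.injOn (Finset.mem_univ a)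

theorem momentumPoly_map_eval (K : Kinematics n) (hσ : Function.Injective σ) {z : ℂ}
    (hz : ∀ a, z ≠ σ a) :
    (K.momentumPoly σ).map (eval z) =
      (nodal Finset.univ σ).eval z • ∑ a, (z - σ a)⁻¹ • K.bispinor a := by
  ext i j
  rw [map_apply, momentumPoly, of_apply, eval_interpolate_not_at_node _ fun a _ => hz a,
    Matrix.smul_apply, Matrix.sum_apply, smul_eq_mul]
  congr 1
  refine Finset.sum_congr rfl fun a ha => ?_
  rw [Matrix.smul_apply, smul_eq_mul]
  have := nodalWeight_ne_zero hσ.injOn ha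
  field_simp

theorem IsSolution.det_momentumPoly (h : K.IsSolution σ) : (K.momentumPoly σ).det = 0 := by
  refine Polynomial.funext fun z => ?_
  rw [eval_zero, ← coe_evalRingHom, RingHom.map_det, RingHom.mapMatrix_apply, coe_evalRingHom]
  by_cases hz : ∃ a, σ a = z
  · obtain ⟨a, rfl⟩ := hz
    rw [momentumPoly_map_eval_node K h.1, det_smul, bispinor, det_vecMulVec, mul_zero]
  · push Not at hz
    rw [momentumPoly_map_eval K h.1 fun a => (hz a).symm, det_smul,
      h.det_sum_inv_smul_bispinor fun a => (hz a).symm, mul_zero]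

theorem Phi_mulVec (K : Kinematics n) (σ u : Fin n → ℂ) (a : Fin n) :
    (K.Phi σ *ᵥ u) a = ∑ b, K.s a b * (u b - u a) / (σ a - σ b) ^ 2 := by
  rw [mulVec, dotProduct, ← Finset.add_sum_erase _ _ (Finset.mem_univ a),
    ← Finset.add_sum_erase _ _ (Finset.mem_univ a), s_self, zero_mul, zero_div, zero_add]
  simp only [Phi, of_apply, if_true]
  rw [neg_mul, Finset.sum_mul, neg_add_eq_sub, ← Finset.sum_sub_distrib]
  refine Finset.sum_congr rfl fun b hb => ?_
  rw [if_neg (Finset.ne_of_mem_erase hb).symm]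
  ring

-- The term with `A` drops out by the scattering equations, the one with `B` by hypothesis.
theorem IsSolution.Phi_mulVec_eq_zero (h : K.IsSolution σ) {u A : Fin n → ℂ}
    {B : Fin n → Fin n → ℂ}
    (hu : ∀ a b, u b - u a = A a * (σ a - σ b) + B a b * (σ a - σ b) ^ 2)
    (hB : ∀ a, ∑ b, B a b * K.s a b = 0) : K.Phi σ *ᵥ u = 0 := by
  funext a
  have hterm : ∀ b, K.s a b * (u b - u a) / (σ a - σ b) ^ 2 =
      A a * (K.s a b / (σ a - σ b)) + B a b * K.s a b := by
    intro b
    rcases eq_or_ne a b with rfl | hab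
    · simp only [s_self, zero_mul, zero_div, mul_zero, add_zero]
    have := sub_ne_zero.mpr (h.1.ne hab)
    rw [hu a b]
    field_simp
  simp only [Phi_mulVec, hterm, Finset.sum_add_distrib, ← Finset.mul_sum, h.sum_eq_zero, hB,
    mul_zero, add_zero, Pi.zero_apply]

theorem IsSolution.Phi_mulVec_evalNodes_eq_zero (h : K.IsSolution σ) {f : ℂ[X]}
    (hf : f ∈ degreeLT ℂ 3) : K.Phi σ *ᵥ evalNodes σ f = 0 := by
  have hX : ∀ k ∈ Finset.range 3, K.Phi σ *ᵥ evalNodes σ (X ^ k) = 0 := by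
    intro k hk
    have hk3 := Finset.mem_range.mp hk
    interval_cases k
    · exact h.Phi_mulVec_eq_zero (A := 0) (B := 0) (by simp) (by simp)
    · exact h.Phi_mulVec_eq_zero (A := -1) (B := 0) (by simp) (by simp)
    · exact h.Phi_mulVec_eq_zero (A := fun a => -2 * σ a) (B := 1)
        (fun a b => by simp only [evalNodes_apply, eval_pow, eval_X, Pi.one_apply]; ring)
        fun a => by simpa using K.sum_s_eq_zero a
  rw [degreeLT_eq_span_X_pow] at hf
  have hle : Submodule.span ℂ ((Finset.range 3).image fun k => (X : ℂ[X]) ^ k) ≤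
      ((K.Phi σ).mulVecLin ∘ₗ evalNodes σ).ker := by
    rw [Submodule.span_le]
    intro g hg
    obtain ⟨k, hk, rfl⟩ := Finset.mem_image.mp (Finset.mem_coe.mp hg)
    exact hX k hk
  exact hle hf

theorem IsSolution.exists_evalNodes_eq (h : K.IsSolution σ) (hnd : K.IsNondegenerate σ)
    {u : Fin n → ℂ} (hu : K.Phi σ *ᵥ u = 0) : ∃ f ∈ degreeLT ℂ 3, evalNodes σ f = u := by
  have hle : (degreeLT ℂ 3).map (evalNodes σ) ≤ (K.Phi σ).mulVecLin.ker := by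
    rintro _ ⟨f, hf, rfl⟩
    exact h.Phi_mulVec_evalNodes_eq_zero hf
  have hnullity := LinearMap.finrank_range_add_finrank_ker (K.Phi σ).mulVecLin
  rw [Module.finrank_fin_fun] at hnullity
  rw [IsNondegenerate, Matrix.rank] at hnd
  have hker : (degreeLT ℂ 3).map (evalNodes σ) = (K.Phi σ).mulVecLin.ker := by
    refine Submodule.eq_of_le_of_finrank_eq hle ?_
    rw [finrank_map_evalNodes_degreeLT h.1 (by rw [Fintype.card_fin]; omega)]
    omega
  exact (hker ▸ hu : u ∈ (degreeLT ℂ 3).map (evalNodes σ))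

-- Otherwise `Φ` would also annihilate `σ³`, which is not quadratic in `σ`.
theorem IsSolution.sum_smul_bispinor_ne_zero (hn : 4 ≤ n) (h : K.IsSolution σ)
    (hnd : K.IsNondegenerate σ) : ∑ a, σ a • K.bispinor a ≠ 0 := by
  intro hmoment
  have hcube : K.Phi σ *ᵥ evalNodes σ (X ^ 3) = 0 := by
    refine h.Phi_mulVec_eq_zero (A := fun a => -3 * σ a ^ 2) (B := fun a b => 2 * σ a + σ b)
      (fun a b => by simp only [evalNodes_apply, eval_pow, eval_X]; ring) fun a => ?_
    simp only [add_mul, Finset.sum_add_distrib, ← Finset.mul_sum, K.sum_s_eq_zero,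
      sum_mul_s_eq_zero hmoment, mul_zero, add_zero]
  obtain ⟨f, hf, hfX⟩ := h.exists_evalNodes_eq hnd hcube
  have hfdeg : f.degree < 3 := mem_degreeLT.mp hf
  have hfeq : f = X ^ 3 := by
    refine eq_of_evalNodes_eq h.1 (hfdeg.trans ?_) ?_ hfX
    · rw [Fintype.card_fin]; exact_mod_cast hn
    · rw [degree_X_pow, Fintype.card_fin]; exact_mod_cast hn
  rw [hfeq, degree_X_pow] at hfdeg
  exact lt_irrefl _ hfdeg

-- Otherwise `Φ` would also annihilate `(z - σ)⁻¹`, which is not quadratic in `σ`.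
theorem IsSolution.sum_inv_smul_bispinor_ne_zero (hn : 4 ≤ n) (h : K.IsSolution σ)
    (hnd : K.IsNondegenerate σ) {z : ℂ} (hz : ∀ a, z ≠ σ a) :
    ∑ a, (z - σ a)⁻¹ • K.bispinor a ≠ 0 := by
  intro hzero
  have hne : ∀ a, z - σ a ≠ 0 := fun a => sub_ne_zero.mpr (hz a)
  have hinv : K.Phi σ *ᵥ (fun a => (z - σ a)⁻¹) = 0 := by
    refine h.Phi_mulVec_eq_zero (A := fun a => -((z - σ a) ^ 2)⁻¹)
      (B := fun a b => ((z - σ a) ^ 2)⁻¹ * (z - σ b)⁻¹) (fun a b => ?_) fun a => ?_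
    · have := hne a
      have := hne b
      field_simp
      ring
    · simp only [mul_assoc, ← Finset.mul_sum, sum_mul_s_eq_zero hzero, mul_zero]
  obtain ⟨f, hf, hfinv⟩ := h.exists_evalNodes_eq hnd hinv
  have hone : (C z - X) * f = 1 := by
    refine eq_of_evalNodes_eq h.1 ?_ ?_ (funext fun a => ?_)
    · have hmem : (C z - X) * f ∈ degreeLT ℂ (3 + 1) := by
        rw [sub_mul, ← smul_eq_C_mul]
        exact Submodule.sub_mem _ (Submodule.smul_mem _ z (degreeLT_mono (Nat.le_succ 3) hf))
          (X_mul_mem_degreeLT hf)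
      exact (mem_degreeLT.mp hmem).trans_le (by rw [Fintype.card_fin]; exact_mod_cast hn)
    · rw [degree_one, Fintype.card_fin]; exact_mod_cast (by omega)
    · have hfa : f.eval (σ a) = (z - σ a)⁻¹ := congrFun hfinv a
      simp [hfa, hne a]
  simpa using congrArg (eval z) hone

theorem IsSolution.momentumPoly_map_eval_ne_zero (hn : 4 ≤ n) (h : K.IsSolution σ)
    (hnd : K.IsNondegenerate σ) (hbi : ∀ a, K.bispinor a ≠ 0) (z : ℂ) :
    (K.momentumPoly σ).map (eval z) ≠ 0 := by
  by_cases hz : ∃ a, σ a = z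
  · obtain ⟨a, rfl⟩ := hz
    rw [momentumPoly_map_eval_node K h.1]
    exact smul_ne_zero (inv_ne_zero (nodalWeight_ne_zero h.1.injOn (Finset.mem_univ a))) (hbi a)
  · push Not at hz
    rw [momentumPoly_map_eval K h.1 fun a => (hz a).symm]
    exact smul_ne_zero (eval_nodal_not_at_node fun a _ => (hz a).symm)
      (h.sum_inv_smul_bispinor_ne_zero hn hnd fun a => (hz a).symm)

theorem nodalWeight_mul_eval_momentumPoly (K : Kinematics n) (hσ : Function.Injective σ)
    (i j : Fin 2) (a : Fin n) :
    nodalWeight Finset.univ σ a * (K.momentumPoly σ i j).eval (σ a) = K.bispinor a i j := by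
  have hvalue := congrFun (congrFun (momentumPoly_map_eval_node K hσ a) i) j
  rw [map_apply, Matrix.smul_apply, smul_eq_mul] at hvalue
  rw [hvalue, mul_inv_cancel_left₀ (nodalWeight_ne_zero hσ.injOn (Finset.mem_univ a))]

theorem momentumPoly_apply_degree_lt (K : Kinematics n) (hσ : Function.Injective σ)
    (i j : Fin 2) : (K.momentumPoly σ i j).degree < (n - 1 : ℕ) := by
  have hdeg : (K.momentumPoly σ i j).degree < Fintype.card (Fin n) :=
    degree_interpolate_lt (s := Finset.univ) _ hσ.injOn
  have hsum := degree_lt_card_sub_one hσ hdeg (by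
    simp only [nodalWeight_mul_eval_momentumPoly K hσ, ← Matrix.sum_apply, sum_bispinor,
      Matrix.zero_apply])
  rwa [Fintype.card_fin] at hsum

theorem momentumPoly_apply_coeff (K : Kinematics n) (hn : 2 ≤ n) (hσ : Function.Injective σ)
    (i j : Fin 2) :
    (K.momentumPoly σ i j).coeff (n - 2) = (∑ a, σ a • K.bispinor a) i j := by
  have hcoeff := coeff_card_sub_two_eq_sum hσ (by rwa [Fintype.card_fin])
    (by rw [Fintype.card_fin]; exact momentumPoly_apply_degree_lt K hσ i j)
  rw [Fintype.card_fin] at hcoeff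
  simp only [hcoeff, mul_left_comm _ (σ _), nodalWeight_mul_eval_momentumPoly K hσ,
    Matrix.sum_apply, Matrix.smul_apply, smul_eq_mul]

/-- The momenta are the residues of a rank-one polynomial matrix `L N` divided by `∏ (z - σ_a)`:
with the nodal weights `w_a = ∏_{b ≠ a} 1 / (σ_a - σ_b)` one has `|a⟩|a] = w_a L(σ_a) N(σ_a)`.
Thus `L` and `N` interpolate, up to little-group scalings, the spinors `|a⟩` and `|a]`. -/
structure IsSpinorFactorization (K : Kinematics n) (σ : Fin n → ℂ) (L N : Fin 2 → ℂ[X]) :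
    Prop where
  isCoprime_left : IsCoprime (L 0) (L 1)
  isCoprime_right : IsCoprime (N 0) (N 1)
  bispinor_eq : ∀ a, K.bispinor a =
    nodalWeight Finset.univ σ a • vecMulVec (evalPair L (σ a)) (evalPair N (σ a))
  degree_add : pairDegree L + pairDegree N + 2 = n

theorem IsSolution.exists_isSpinorFactorization (hn : 4 ≤ n) (h : K.IsSolution σ)
    (hnd : K.IsNondegenerate σ) (hbi : ∀ a, K.bispinor a ≠ 0) :
    ∃ L N, K.IsSpinorFactorization σ L N := by
  obtain ⟨L, N, hL, hP⟩ := exists_eq_vecMulVec_of_det_eq_zero h.det_momentumPoly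
  have hPz : ∀ z, (K.momentumPoly σ).map (eval z) = vecMulVec (evalPair L z) (evalPair N z) :=
    fun z => by ext i j; rw [hP, map_apply, vecMulVec_apply, eval_mul]; rfl
  have hN : IsCoprime (N 0) (N 1) := isCoprime_of_evalPair_ne_zero fun z hz =>
    h.momentumPoly_map_eval_ne_zero hn hnd hbi z (by rw [hPz, hz, vecMulVec_zero])
  have hdegree : pairDegree L + pairDegree N = n - 2 := by
    have hLN : ∀ i j, K.momentumPoly σ i j = L i * N j := fun i j => by rw [hP, vecMulVec_apply]
    refine pairDegree_add_pairDegree (fun i j => ?_) ?_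
    · rw [← hLN, show n - 2 + 1 = n - 1 by omega]
      exact momentumPoly_apply_degree_lt K h.1 i j
    · simp only [← hLN, momentumPoly_apply_coeff K (by omega) h.1]
      by_contra! hzero
      exact h.sum_smul_bispinor_ne_zero hn hnd (Matrix.ext hzero)
  refine ⟨L, N, hL, hN, fun a => ?_, by omega⟩
  rw [← hPz, momentumPoly_map_eval_node K h.1,
    smul_inv_smul₀ (nodalWeight_ne_zero h.1.injOn (Finset.mem_univ a))]

theorem discMinus_mulVec_eq_zero {q : Fin 2 → ℂ} (hq : ∀ a, square (K.lamT a) q ≠ 0)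
    (σ : Fin n → ℂ) : (K.discMinus q σ *ᵥ fun a => square (K.lamT a) q) = 0 := by
  funext a
  rw [mulVec, dotProduct, ← Finset.add_sum_erase _ _ (Finset.mem_univ a)]
  simp only [discMinus, of_apply, if_true]
  rw [neg_mul, Finset.sum_mul, neg_add_eq_sub, ← Finset.sum_sub_distrib]
  refine Finset.sum_eq_zero fun b hb => ?_
  rw [if_neg (Finset.ne_of_mem_erase hb).symm, div_mul_eq_div_div, div_mul_cancel₀ _ (hq a)]
  ring

namespace IsSpinorFactorization

variable {L N : Fin 2 → ℂ[X]} {q : Fin 2 → ℂ}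

theorem lam_eq (h : K.IsSpinorFactorization σ L N) {a : Fin n} (hqa : square (K.lamT a) q ≠ 0) :
    K.lam a = (nodalWeight Finset.univ σ a * square (evalPair N (σ a)) q / square (K.lamT a) q) •
      evalPair L (σ a) := by
  funext i
  have hentry : ∀ j, K.lam a i * K.lamT a j =
      nodalWeight Finset.univ σ a * (evalPair L (σ a) i * evalPair N (σ a) j) := fun j =>
    congrFun (congrFun (h.bispinor_eq a) i) j
  rw [Pi.smul_apply, smul_eq_mul, div_mul_eq_mul_div, eq_div_iff hqa, square, square]
  linear_combination q 0 * hentry 1 - q 1 * hentry 0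

theorem exists_discMinus_eq (h : K.IsSpinorFactorization σ L N) (hσ : Function.Injective σ)
    (hlam : ∀ a, K.lam a ≠ 0) (hq : ∀ a, square (K.lamT a) q ≠ 0) :
    ∃ t : Fin n → ℂ, (∀ a, t a ≠ 0) ∧
      K.discMinus q σ = diagonal t * bezoutMatrix L σ * diagonal t := by
  set f : ℂ[X] := C (q 0) * N 1 - C (q 1) * N 0 with hf
  have hf_eval : ∀ z, f.eval z = square (evalPair N z) q := fun z => by
    simp only [hf, eval_sub, eval_mul, eval_C, square, evalPair]
    ring
  set t := fun a => nodalWeight Finset.univ σ a * f.eval (σ a) / square (K.lamT a) q with ht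
  have hlam_eq : ∀ a, K.lam a = t a • evalPair L (σ a) := fun a => by
    rw [h.lam_eq (hq a), ← hf_eval]
  refine ⟨t, fun a ha => hlam a (by rw [hlam_eq, ha, zero_smul]), ?_⟩
  refine eq_of_off_diagonal_eq_of_mulVec_eq hq (fun a b hab => ?_) ?_
  · simp only [discMinus, of_apply, if_neg hab, mul_diagonal, diagonal_mul, bezoutMatrix,
      eval_bezoutian_of_ne L (hσ.ne hab), hlam_eq, angle, Pi.smul_apply, smul_eq_mul, evalPair]
    ring
  have hfN : f ∈ degreeLT ℂ (Fintype.card (Fin n) - pairDegree L) := by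
    have hN : ∀ i, N i ∈ degreeLT ℂ (Fintype.card (Fin n) - pairDegree L) := fun i => by
      have := natDegree_le_pairDegree N i
      have := h.degree_add
      refine mem_degreeLT.mpr (degree_le_natDegree.trans_lt ?_)
      rw [Fintype.card_fin]
      exact_mod_cast (by omega)
    rw [hf, ← smul_eq_C_mul, ← smul_eq_C_mul]
    exact Submodule.sub_mem _ (Submodule.smul_mem _ _ (hN 1)) (Submodule.smul_mem _ _ (hN 0))
  have hdiagonal : (diagonal t *ᵥ fun a => square (K.lamT a) q) =
      nodalWeight Finset.univ σ * evalNodes σ f := funext fun a => by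
    rw [mulVec_diagonal, ht]
    exact div_mul_cancel₀ _ (hq a)
  have hkernel := (mem_map_evalNodes_iff hσ h.isCoprime_left
    (by rw [Fintype.card_fin]; have := h.degree_add; omega) _).mp ⟨f, hfN, rfl⟩
  rw [discMinus_mulVec_eq_zero hq, ← mulVec_mulVec, ← mulVec_mulVec, hdiagonal, hkernel,
    mulVec_zero]

theorem rank_discMinus (h : K.IsSpinorFactorization σ L N) (hσ : Function.Injective σ)
    (hlam : ∀ a, K.lam a ≠ 0) (hq : ∀ a, square (K.lamT a) q ≠ 0) :
    (K.discMinus q σ).rank = pairDegree L := by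
  obtain ⟨t, ht, hdisc⟩ := h.exists_discMinus_eq hσ hlam hq
  have hdet : (diagonal t).det ≠ 0 := by
    rw [det_diagonal]
    exact Finset.prod_ne_zero_iff.mpr fun a _ => ht a
  have hlt : pairDegree L < Fintype.card (Fin n) := by
    have := h.degree_add
    rw [Fintype.card_fin]
    omega
  rw [hdisc, rank_mul_eq_left_of_det_ne_zero _ _ hdet, rank_mul_eq_right_of_det_ne_zero _ _ hdet,
    rank_bezoutMatrix hσ h.isCoprime_left hlt]

end IsSpinorFactorization

theorem momentum_swap (x y : Fin 2 → ℂ) : momentum y x = ![1, 1, -1, 1] * momentum x y := by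
  funext μ
  fin_cases μ <;> simp only [momentum, Pi.mul_apply, cons_val, Fin.reduceFinMk, Fin.zero_eta,
    Fin.mk_one] <;> ring

/-- The parity-conjugate kinematics, with the roles of `|a⟩` and `|a]` exchanged. -/
def parity (K : Kinematics n) : Kinematics n where
  lam := K.lamT
  lamT := K.lam
  conservation := by
    have hswap := fun a => momentum_swap (K.lam a) (K.lamT a)
    simp only [hswap, ← Finset.mul_sum, K.conservation, mul_zero]

theorem angle_eq_neg_square (x y : Fin 2 → ℂ) : angle x y = -square x y := by
  rw [angle, square]
  ring

theorem discPlus_eq_neg_parity_discMinus (K : Kinematics n) (p : Fin 2 → ℂ) (σ : Fin n → ℂ) :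
    K.discPlus p σ = -K.parity.discMinus p σ := by
  ext a b
  simp only [discPlus, discMinus, parity, of_apply, Matrix.neg_apply,
    angle_eq_neg_square]
  split_ifs
  · simp only [neg_mul, mul_neg, div_neg, neg_div, Finset.sum_neg_distrib, neg_neg]
  · ring

namespace IsSpinorFactorization

variable {L N : Fin 2 → ℂ[X]} {p : Fin 2 → ℂ}

theorem parity (h : K.IsSpinorFactorization σ L N) : K.parity.IsSpinorFactorization σ N L where
  isCoprime_left := h.isCoprime_right
  isCoprime_right := h.isCoprime_left
  bispinor_eq a := by
    rw [← transpose_vecMulVec (evalPair L _), ← transpose_smul, ← h.bispinor_eq, bispinor,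
      bispinor, transpose_vecMulVec]
    rfl
  degree_add := by rw [add_comm (pairDegree N), h.degree_add]

theorem rank_discPlus (h : K.IsSpinorFactorization σ L N) (hσ : Function.Injective σ)
    (hlamT : ∀ a, K.lamT a ≠ 0) (hp : ∀ a, angle (K.lam a) p ≠ 0) :
    (K.discPlus p σ).rank = pairDegree N := by
  rw [discPlus_eq_neg_parity_discMinus, rank_neg]
  refine h.parity.rank_discMinus hσ hlamT fun a ha => hp a ?_
  rw [angle_eq_neg_square, neg_eq_zero]
  exact ha

theorem s_eq (h : K.IsSpinorFactorization σ L N) (a b : Fin n) :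
    K.s a b = -(nodalWeight Finset.univ σ a * nodalWeight Finset.univ σ b *
      (angle (evalPair L (σ a)) (evalPair L (σ b)) *
        square (evalPair N (σ a)) (evalPair N (σ b)))) := by
  rw [s_eq_trace, h.bispinor_eq, h.bispinor_eq, ← smul_vecMulVec, ← smul_vecMulVec,
    trace_adjugate_vecMulVec_mul]
  simp only [angle, Pi.smul_apply, smul_eq_mul]
  ring

theorem pairDegree_pos (h : K.IsSpinorFactorization σ L N) (hs : ∃ a b, K.s a b ≠ 0) :
    0 < pairDegree L ∧ 0 < pairDegree N := by
  obtain ⟨a, b, hab⟩ := hs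
  rw [h.s_eq] at hab
  refine ⟨Nat.pos_of_ne_zero fun h0 => hab ?_, Nat.pos_of_ne_zero fun h0 => hab ?_⟩
  · rw [evalPair_eq_of_pairDegree_eq_zero h0 (σ a) (σ b), angle]
    ring
  · rw [evalPair_eq_of_pairDegree_eq_zero h0 (σ a) (σ b), square]
    ring

end IsSpinorFactorization

theorem IsNondegenerate.exists_s_ne_zero (hn : 4 ≤ n) (hnd : K.IsNondegenerate σ) :
    ∃ a b, K.s a b ≠ 0 := by
  by_contra! hzero
  have hPhi : K.Phi σ = 0 := by
    ext a b
    simp only [Phi, of_apply, hzero, zero_div, Finset.sum_const_zero, neg_zero, ite_self,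
      Matrix.zero_apply]
  rw [IsNondegenerate, hPhi, rank_zero] at hnd
  omega

theorem IsReal.conj_mom (hK : K.IsReal) (a : Fin n) (μ : Fin 4) :
    conj (K.mom a μ) = K.mom a μ :=
  Complex.conj_eq_iff_im.mpr (hK a μ)

theorem IsReal.conjTranspose_bispinor (hK : K.IsReal) (a : Fin n) :
    (K.bispinor a)ᴴ = K.bispinor a := by
  have h0 := hK.conj_mom a 0
  have h1 := hK.conj_mom a 1
  have h2 := hK.conj_mom a 2
  have h3 := hK.conj_mom a 3
  simp only [mom, momentum, cons_val, map_div₀, map_add, map_sub, map_mul, Complex.conj_I,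
    map_ofNat] at h0 h1 h2 h3
  ext i j
  simp only [bispinor, conjTranspose_vecMulVec, vecMulVec_apply, Pi.star_apply, Complex.star_def]
  set x := K.lam a
  set y := K.lamT a
  fin_cases i <;> fin_cases j <;> simp only [Fin.zero_eta, Fin.mk_one, Fin.isValue]
  · linear_combination h0 + h3
  · linear_combination h1 - Complex.I * h2 - (1 / 2) * (conj (x 0) * conj (y 1) -
      conj (x 1) * conj (y 0) + x 0 * y 1 - x 1 * y 0) * Complex.I_sq
  · linear_combination h1 + Complex.I * h2 + (1 / 2) * (conj (x 0) * conj (y 1) -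
      conj (x 1) * conj (y 0) + x 0 * y 1 - x 1 * y 0) * Complex.I_sq
  · linear_combination h0 - h3

theorem IsReal.conj_s (hK : K.IsReal) (a b : Fin n) : conj (K.s a b) = K.s a b := by
  simp only [s, minkowski, map_mul, map_sub, map_ofNat, hK.conj_mom]

theorem IsReal.isSolution_star (hK : K.IsReal) (h : K.IsSolution σ) : K.IsSolution (star σ) := by
  refine ⟨star_injective.comp h.1, fun a => ?_⟩
  have hconj := congrArg conj (h.2 a)
  simp only [map_sum, map_div₀, map_sub, hK.conj_s, map_zero] at hconj
  exact hconj

theorem IsReal.isSpinorFactorization_star (hK : K.IsReal) {L N : Fin 2 → ℂ[X]}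
    (h : K.IsSpinorFactorization σ L N) : K.IsSpinorFactorization (star σ)
      (fun i => (N i).map (starRingEnd ℂ)) fun i => (L i).map (starRingEnd ℂ) where
  isCoprime_left := h.isCoprime_right.map (mapRingHom (starRingEnd ℂ))
  isCoprime_right := h.isCoprime_left.map (mapRingHom (starRingEnd ℂ))
  bispinor_eq a := by
    have hweight : nodalWeight Finset.univ (star σ) a = conj (nodalWeight Finset.univ σ a) :=
      nodalWeight_map (starRingEnd ℂ) σ a
    have heval : ∀ M : Fin 2 → ℂ[X], evalPair (fun i => (M i).map (starRingEnd ℂ)) (star σ a) =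
        star (evalPair M (σ a)) := fun M => evalPair_map (starRingEnd ℂ) M (σ a)
    rw [← hK.conjTranspose_bispinor, h.bispinor_eq, conjTranspose_smul, conjTranspose_vecMulVec,
      heval, heval, hweight]
    rfl
  degree_add := by rw [pairDegree_map, pairDegree_map, add_comm (pairDegree N), h.degree_add]

section Ranks

variable {p q : Fin 2 → ℂ}

theorem lam_ne_zero (hp : ∀ a, angle (K.lam a) p ≠ 0) (a : Fin n) : K.lam a ≠ 0 := fun h0 =>
  hp a (by rw [angle, h0, Pi.zero_apply, Pi.zero_apply, zero_mul, zero_mul, sub_zero])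

theorem lamT_ne_zero (hq : ∀ a, square (K.lamT a) q ≠ 0) (a : Fin n) : K.lamT a ≠ 0 := fun h0 =>
  hq a (by rw [square, h0, Pi.zero_apply, Pi.zero_apply, zero_mul, zero_mul, sub_zero])

theorem IsSolution.rank_discMinus_add_rank_discPlus (hn : 4 ≤ n) (h : K.IsSolution σ)
    (hnd : K.IsNondegenerate σ) (hp : ∀ a, angle (K.lam a) p ≠ 0)
    (hq : ∀ a, square (K.lamT a) q ≠ 0) :
    (K.discMinus q σ).rank + (K.discPlus p σ).rank + 2 = n := by
  obtain ⟨L, N, hLN⟩ := h.exists_isSpinorFactorization hn hnd fun a =>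
    vecMulVec_ne_zero (lam_ne_zero hp a) (lamT_ne_zero hq a)
  rw [hLN.rank_discMinus h.1 (lam_ne_zero hp) hq, hLN.rank_discPlus h.1 (lamT_ne_zero hq) hp,
    hLN.degree_add]

theorem IsSolution.rank_disc_pos (hn : 4 ≤ n) (h : K.IsSolution σ)
    (hnd : K.IsNondegenerate σ) (hp : ∀ a, angle (K.lam a) p ≠ 0)
    (hq : ∀ a, square (K.lamT a) q ≠ 0) :
    0 < (K.discMinus q σ).rank ∧ 0 < (K.discPlus p σ).rank := by
  obtain ⟨L, N, hLN⟩ := h.exists_isSpinorFactorization hn hnd fun a =>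
    vecMulVec_ne_zero (lam_ne_zero hp a) (lamT_ne_zero hq a)
  rw [hLN.rank_discMinus h.1 (lam_ne_zero hp) hq, hLN.rank_discPlus h.1 (lamT_ne_zero hq) hp]
  exact hLN.pairDegree_pos (hnd.exists_s_ne_zero hn)

theorem IsReal.rank_discMinus_star (hK : K.IsReal) (hn : 4 ≤ n) (h : K.IsSolution σ)
    (hnd : K.IsNondegenerate σ) (hp : ∀ a, angle (K.lam a) p ≠ 0)
    (hq : ∀ a, square (K.lamT a) q ≠ 0) :
    (K.discMinus q (star σ)).rank = (K.discPlus p σ).rank := by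
  obtain ⟨L, N, hLN⟩ := h.exists_isSpinorFactorization hn hnd fun a =>
    vecMulVec_ne_zero (lam_ne_zero hp a) (lamT_ne_zero hq a)
  have hstar := hK.isSpinorFactorization_star hLN
  rw [hstar.rank_discMinus (hK.isSolution_star h).1 (lam_ne_zero hp) hq, pairDegree_map,
    hLN.rank_discPlus h.1 (lamT_ne_zero hq) hp]

end Ranks

end Kinematics

section Conjugation

variable {n : ℕ}

theorem mem_conjSet {P : Set (Fin n → ℂ)} {τ : Fin n → ℂ} : τ ∈ conjSet P ↔ star τ ∈ P :=
  Set.mem_image_iff_of_inverse (star_star (R := Fin n → ℂ)) (star_star (R := Fin n → ℂ))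

theorem conjSet_conjSet (P : Set (Fin n → ℂ)) : conjSet (conjSet P) = P :=
  Set.ext fun τ => by rw [mem_conjSet, mem_conjSet, star_star]

theorem mobiusSetoid_star {σ τ : Fin n → ℂ} (h : (mobiusSetoid n).r σ τ) :
    (mobiusSetoid n).r (star σ) (star τ) := by
  obtain ⟨g, hg⟩ := h
  exact ⟨g.map (starRingEnd ℂ), fun a =>
    (OnePoint.map_smul (starRingEnd ℂ) g (σ a)).symm.trans (by rw [hg a]; rfl)⟩

/-- Complex conjugation of Möbius classes of puncture configurations. -/
def conjClass : Quotient (mobiusSetoid n) → Quotient (mobiusSetoid n) :=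
  Quotient.map star fun _ _ => mobiusSetoid_star

theorem conjClass_involutive : Function.Involutive (conjClass (n := n)) := by
  rintro ⟨σ⟩
  exact congrArg (Quotient.mk _) (star_star σ)

theorem mobiusClasses_conjSet (P : Set (Fin n → ℂ)) :
    mobiusClasses (conjSet P) = conjClass '' mobiusClasses P := by
  rw [mobiusClasses, mobiusClasses, conjSet, Set.image_image, Set.image_image]
  rfl

theorem mk_mobiusClasses_conjSet (P : Set (Fin n → ℂ)) :
    Cardinal.mk (mobiusClasses (conjSet P)) = Cardinal.mk (mobiusClasses P) := by
  rw [mobiusClasses_conjSet, Cardinal.mk_image_eq conjClass_involutive.injective]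

theorem Kinematics.IsReal.conjSet_PMinus {K : Kinematics n} {p q : Fin 2 → ℂ} (hreal : K.IsReal)
    (hn : 4 ≤ n) (hK : ∀ σ, K.IsSolution σ → K.IsNondegenerate σ)
    (hp : ∀ a, angle (K.lam a) p ≠ 0) (hq : ∀ a, square (K.lamT a) q ≠ 0) (m : ℕ) :
    conjSet (K.PMinus q m) = K.PPlus p m := by
  ext τ
  have hsol : K.IsSolution (star τ) ↔ K.IsSolution τ :=
    ⟨fun h => star_star τ ▸ hreal.isSolution_star h, hreal.isSolution_star⟩
  rw [mem_conjSet, Kinematics.PMinus, Set.mem_ofPred_eq, hsol]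
  exact and_congr_right fun h => by rw [hreal.rank_discMinus_star hn h (hK τ h) hp hq]

end Conjugation

end CHY

theorem mainTheorem2 (n : ℕ) (hn : 4 ≤ n) (K : CHY.Kinematics n)
    (hK : ∀ σ, K.IsSolution σ → K.IsNondegenerate σ)
    (p q : Fin 2 → ℂ)
    (hp : ∀ a, CHY.angle (K.lam a) p ≠ 0) (hq : ∀ a, CHY.square (K.lamT a) q ≠ 0) :
    (∀ σ, K.IsSolution σ → ∃ m, m ≤ n - 4 ∧ σ ∈ K.PMinus q m) ∧
    (∀ m, ∀ σ ∈ K.PMinus q m,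
      m ≤ n - 4 ∧
      (K.discMinus q σ).rank = m + 1 ∧
      (K.discPlus p σ).rank = n - m - 3 ∧
      (K.discMinus q σ).rank + (K.discPlus p σ).rank = n - 2) ∧
    (∀ k, k ≤ n - 4 → K.PPlus p (n - k - 4) = K.PMinus q k) ∧
    (K.IsReal → ∀ k, k ≤ n - 4 →
      K.PPlus p (n - k - 4) = CHY.conjSet (K.PMinus q (n - k - 4)) ∧
      CHY.conjSet (K.PMinus q (n - k - 4)) = K.PMinus q k ∧
      CHY.conjSet (K.PMinus q k) = K.PMinus q (n - k - 4) ∧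
      Cardinal.mk (CHY.mobiusClasses (K.PMinus q k)) =
        Cardinal.mk (CHY.mobiusClasses (K.PMinus q (n - k - 4)))) := by
  have hsum := fun σ (h : K.IsSolution σ) =>
    h.rank_discMinus_add_rank_discPlus hn (hK σ h) hp hq
  have hpos := fun σ (h : K.IsSolution σ) => h.rank_disc_pos hn (hK σ h) hp hq
  have hflip : ∀ k, k ≤ n - 4 → K.PPlus p (n - k - 4) = K.PMinus q k := fun k hk =>
    Set.ext fun σ => and_congr_right fun h => by have := hsum σ h; omega
  refine ⟨fun σ h => ⟨(K.discMinus q σ).rank - 1, ?_, h, ?_⟩, fun m σ ⟨h, hm⟩ => ?_, hflip,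
    fun hreal k hk => ?_⟩
  · have := hsum σ h; have := hpos σ h; omega
  · have := hpos σ h; omega
  · have := hsum σ h; have := hpos σ h; omega
  · have hconj := hreal.conjSet_PMinus hn hK hp hq (n - k - 4)
    have hswap := hconj.trans (hflip k hk)
    refine ⟨hconj.symm, hswap, ?_, ?_⟩
    · rw [← hswap, CHY.conjSet_conjSet]
    · rw [← hswap, CHY.mk_mobiusClasses_conjSet]
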